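/- Let $X$ be a proper geodesic Gromov hyperbolic metric space and let $Y$ be a geodesic Gromov hyperbolic metric space (not assumed proper) that is geodesically rich. Suppose there is a quasi-isometric embedding $f:X\to Y$ whose induced boundary map $\partial f:\partial X\to\partial Y$, $[\{x_i\}]\mapsto[\{f(x_i)\}]$, is a bijection. Then $X$ is boundary rigid and $\partial X$ is uniformly perfect. Here the following conventions are used. A geodesic space is Gromov hyperbolic if there is $\delta\ge 0$ such that each point on an edge of a geodesic triangle is within $\delta$ of the union of the other two edges. With $(x|y)_w=\frac12\big(d(x,w)+d(y,w)-d(x,y)\big)$, the boundary $\partial X$ is the set of sequences $\{x_i\}$ with $(x_i|x_j)_w\to\infty$ as $i,j\to\infty$, modulo $\{x_i\}\sim\{y_i\}$ iff $(x_i|y_i)_w\to\infty$; for $\xi,\zeta\in\partial X$, $(\xi|\zeta)_w=\inf\{\liminf_{i}(x_i|y_i)_w : \{x_i\}\in\xi,\ \{y_i\}\in\zeta\}$. A map $f$ is a quasi-isometric embedding if $K^{-1}d(x,y)-C\le d(f(x),f(y))\le K d(x,y)+C$ for all $x,y$, for some $K\ge1$, $C\ge0$; it is a quasi-isometry if moreover,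 for such $K, C$, every point of the target is within distance $C$ of the image. $X$ is boundary rigid if every quasi-isometry $f:X\to X$ that induces the identity map on $\partial X$ satisfies $\sup_{x\in X}d(x,f(x))<\infty$. A geodesic space $Y$ is geodesically rich if there are constants $r_0,\dots,r_4$ such that (1) for all $p,q\in Y$ with $d(p,q)\ge r_0$ there is a bi-infinite geodesic $\gamma$ with $d(p,\gamma)<r_1$ and $|d(q,\gamma)-d(p,q)|<r_2$; and (2) for every bi-infinite geodesic $\gamma$ and every $p\in Y$ there is a bi-infinite geodesic $\gamma'$ with $d(p,\gamma')<r_3$ and $|d(p,\gamma)-d(\gamma',\gamma)|<r_4$. A metric space $(Z,d)$ is uniformly perfect if there are $S\ge1$ and $r_0>0$ such that for every $x\in Z$ and $0<r\le r_0$ there is $y\in Z$ with $r/S<d(x,y)\le r$. The boundary $\partial X$ is uniformly perfect if it is so for every visual metric $d_{w,\varepsilon}(\xi,\zeta)=\inf\sum_{i=1}^n e^{-\varepsilon(\xi_{i-1}|\xi_i)_w}$, where the infimum is over all finite chains $\xi=\xi_0,\dots,\xi_n=\zeta$ in $\partial X$ with $n\ge1$, $w\in X$ is any base point, and $0<\varepsilon<\min\{1,\frac1{5\delta}\}$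 for some $\delta>0$ such that all geodesic triangles of $X$ are $\delta$-thin (any two points of a triangle with the same image in its comparison tripod are at distance at most $\delta$). -/

import Mathlib

open Filter Topology

/-- `γ`, restricted to `[0, d(x, y)]`, is a geodesic from `x` to `y` (parametrized by arc length). -/
def IsGeodesicFromTo {X : Type*} [MetricSpace X] (γ : ℝ → X) (x y : X) : Prop :=
  γ 0 = x ∧ γ (dist x y) = y ∧
    ∀ s ∈ Set.Icc 0 (dist x y), ∀ t ∈ Set.Icc 0 (dist x y), dist (γ s) (γ t) = |s - t|

/-- The set `s` is (the image of) a geodesic segment `[x, y]`. -/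
def IsGeodesicSegment {X : Type*} [MetricSpace X] (x y : X) (s : Set X) : Prop :=
  ∃ γ : ℝ → X, IsGeodesicFromTo γ x y ∧ s = γ '' Set.Icc 0 (dist x y)

/-- Any two points are joined by a geodesic. -/
def IsGeodesicSpace (X : Type*) [MetricSpace X] : Prop :=
  ∀ x y : X, ∃ s : Set X, IsGeodesicSegment x y s

/-- `δ`-hyperbolicity: each point on an edge of a geodesic triangle is within distance `δ` of the
union of the two other edges. -/
def IsDeltaHyperbolic (X : Type*) [MetricSpace X] (δ : ℝ) : Prop :=
  ∀ (x y z : X) (a b c : Set X),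
    IsGeodesicSegment x y a → IsGeodesicSegment y z b → IsGeodesicSegment z x c →
      ∀ p ∈ a, ∃ q ∈ b ∪ c, dist p q ≤ δ

def IsGromovHyperbolic (X : Type*) [MetricSpace X] : Prop :=
  ∃ δ : ℝ, 0 ≤ δ ∧ IsDeltaHyperbolic X δ

/-- The Gromov product `(x|y)_w`. -/
noncomputable def gromovProduct {X : Type*} [MetricSpace X] (w x y : X) : ℝ :=
  (dist x w + dist y w - dist x y) / 2

/-- All geodesic triangles are `δ`-thin: two points of the triangle with the same image in the
comparison tripod are at distance at most `δ`. Two such points on different edges lie on the two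
edges issuing from a vertex `x`, at the same distance `t ≤ (y|z)_x` from `x`. -/
def HasThinTriangles (X : Type*) [MetricSpace X] (δ : ℝ) : Prop :=
  ∀ (x y z : X) (α β : ℝ → X), IsGeodesicFromTo α x y → IsGeodesicFromTo β x z →
    ∀ t : ℝ, 0 ≤ t → t ≤ gromovProduct x y z → dist (α t) (β t) ≤ δ

/-- `(x_i|x_j)_w → ∞` as `i, j → ∞` (the base point `w` is irrelevant). -/
def IsGromovSequence {X : Type*} [MetricSpace X] (x : ℕ → X) : Prop :=
  ∀ w : X, Tendsto (fun p : ℕ × ℕ => gromovProduct w (x p.1) (x p.2)) atTop atTop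

/-- `(x_i|y_i)_w → ∞` as `i → ∞` (the base point `w` is irrelevant). -/
def GromovEquivalent {X : Type*} [MetricSpace X] (x y : ℕ → X) : Prop :=
  ∀ w : X, Tendsto (fun i : ℕ => gromovProduct w (x i) (y i)) atTop atTop

/-- The type of Gromov sequences of `X`. -/
def GromovSequence (X : Type*) [MetricSpace X] : Type _ :=
  {x : ℕ → X // IsGromovSequence x}

/-- The Gromov boundary `∂X`: Gromov sequences up to equivalence. (If `X` is Gromov hyperbolic, the
relation is already an equivalence relation.) -/
def GromovBoundary (X : Type*) [MetricSpace X] : Type _ :=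
  Quot (fun x y : GromovSequence X => GromovEquivalent x.1 y.1)

/-- The boundary point represented by a Gromov sequence. -/
def GromovBoundary.mk {X : Type*} [MetricSpace X] (x : ℕ → X) (hx : IsGromovSequence x) :
    GromovBoundary X :=
  Quot.mk _ ⟨x, hx⟩

/-- The Gromov product `(ξ|ζ)_w` of two boundary points: the infimum of `liminf (x_i|y_i)_w` over
all `(x_i) ∈ ξ`, `(y_i) ∈ ζ`. It may be `+∞`. -/
noncomputable def boundaryGromovProduct {X : Type*} [MetricSpace X] (w : X)
    (ξ ζ : GromovBoundary X) : EReal :=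
  sInf {g : EReal | ∃ (x y : ℕ → X) (hx : IsGromovSequence x) (hy : IsGromovSequence y),
    GromovBoundary.mk x hx = ξ ∧ GromovBoundary.mk y hy = ζ ∧
      g = liminf (fun i : ℕ => ((gromovProduct w (x i) (y i) : ℝ) : EReal)) atTop}

/-- `ρ_{w,ε}(ξ, ζ) = exp(-ε (ξ|ζ)_w)`, with `exp(-∞) = 0`. -/
noncomputable def visualQuasiDist {X : Type*} [MetricSpace X] (w : X) (ε : ℝ)
    (ξ ζ : GromovBoundary X) : ℝ :=
  (EReal.exp (-((ε : EReal) * boundaryGromovProduct w ξ ζ))).toReal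

/-- The visual metric `d_{w,ε}` on `∂X`: the infimum of `∑ ρ_{w,ε}(ξ_{i-1}, ξ_i)` over all finite
chains `ξ = ξ_0, ξ_1, …, ξ_n = ζ`, `n ≥ 1`. -/
noncomputable def visualDist {X : Type*} [MetricSpace X] (w : X) (ε : ℝ)
    (ξ ζ : GromovBoundary X) : ℝ :=
  sInf {s : ℝ | ∃ (n : ℕ) (c : ℕ → GromovBoundary X), 1 ≤ n ∧ c 0 = ξ ∧ c n = ζ ∧
    s = ∑ i ∈ Finset.range n, visualQuasiDist w ε (c i) (c (i + 1))}

/-- Uniform perfectness of a set with respect to a distance function `d`. -/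
def IsUniformlyPerfect {α : Type*} (d : α → α → ℝ) : Prop :=
  ∃ S : ℝ, 1 ≤ S ∧ ∃ r₀ : ℝ, 0 < r₀ ∧
    ∀ x : α, ∀ r : ℝ, 0 < r → r ≤ r₀ → ∃ y : α, r / S < d x y ∧ d x y ≤ r

/-- `∂X` is uniformly perfect: it is so for every visual metric `d_{w,ε}`, where `w` is any base
point and `0 < ε < min{1, 1/(5δ)}` for some `δ > 0` such that all geodesic triangles of `X` are
`δ`-thin. -/
def HasUniformlyPerfectBoundary (X : Type*) [MetricSpace X] : Prop :=
  ∀ (w : X) (δ ε : ℝ), 0 < δ → HasThinTriangles X δ → 0 < ε → ε < min 1 (1 / (5 * δ)) →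
    IsUniformlyPerfect (visualDist w ε)

/-- `f` is a `(K, C)`-quasi-isometric embedding. -/
def IsQIEmbeddingWith {X Y : Type*} [MetricSpace X] [MetricSpace Y] (K C : ℝ) (f : X → Y) : Prop :=
  ∀ x y : X, K⁻¹ * dist x y - C ≤ dist (f x) (f y) ∧ dist (f x) (f y) ≤ K * dist x y + C

def IsQuasiIsometricEmbedding {X Y : Type*} [MetricSpace X] [MetricSpace Y] (f : X → Y) : Prop :=
  ∃ K C : ℝ, 1 ≤ K ∧ 0 ≤ C ∧ IsQIEmbeddingWith K C f

def IsQuasiIsometry {X Y : Type*} [MetricSpace X] [MetricSpace Y] (f : X → Y) : Prop :=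
  ∃ K C : ℝ, 1 ≤ K ∧ 0 ≤ C ∧ IsQIEmbeddingWith K C f ∧
    ∀ y : Y, ∃ x : X, dist y (f x) ≤ C

/-- `F : ∂X → ∂Y` is the boundary map `∂f` induced by `f`, i.e. `F [x_i] = [f x_i]` for every
Gromov sequence `(x_i)`. There is at most one such `F`. -/
def InducesBoundaryMap {X Y : Type*} [MetricSpace X] [MetricSpace Y] (f : X → Y)
    (F : GromovBoundary X → GromovBoundary Y) : Prop :=
  ∀ (x : ℕ → X) (hx : IsGromovSequence x),
    ∃ hfx : IsGromovSequence (fun i => f (x i)),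
      F (GromovBoundary.mk x hx) = GromovBoundary.mk (fun i => f (x i)) hfx

/-- Every self quasi-isometry inducing the identity of `∂X` has finite displacement. -/
def IsBoundaryRigid (X : Type*) [MetricSpace X] : Prop :=
  ∀ f : X → X, IsQuasiIsometry f → InducesBoundaryMap f id → ∃ M : ℝ, ∀ x : X, dist x (f x) ≤ M

/-- Geodesic richness of a (geodesic) metric space. A bi-infinite geodesic is an isometric
embedding of `ℝ`; distances to and between geodesics are infima of distances of points. -/
def IsGeodesicallyRich (X : Type*) [MetricSpace X] : Prop :=
  ∃ r₀ r₁ r₂ r₃ r₄ : ℝ,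
    (∀ p q : X, r₀ ≤ dist p q → ∃ γ : ℝ → X, Isometry γ ∧
      Metric.infDist p (Set.range γ) < r₁ ∧
      |Metric.infDist q (Set.range γ) - dist p q| < r₂) ∧
    (∀ γ : ℝ → X, Isometry γ → ∀ p : X, ∃ γ' : ℝ → X, Isometry γ' ∧
      Metric.infDist p (Set.range γ') < r₃ ∧
      |Metric.infDist p (Set.range γ) - ⨅ st : ℝ × ℝ, dist (γ' st.1) (γ st.2)| < r₄)

/-! Call `p` a coarse center if three boundary points have pairwise bounded Gromov products at `p`;
everything follows once all points of `X` are coarse centers, with a uniform bound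
(`HasCoarseCenters`).

In an unbounded rich `Y`, take a geodesic `γ` near `p`, a far point `q` on it, and the geodesic `γ'`
that richness gives for `(p, q)`: it passes near `p` but about as far from `q` as `p` is. The end of
`γ` beyond `q` and the two ends of `γ'` form the triple. Since `∂f` is onto, triples lift to `∂X`,
and they remain separated because quasi-isometric embeddings coarsely increase Gromov products, a
consequence of stability of quasi-geodesics (`exists_dist_quasigeodesic_le`).

Rigidity: if `∂g = id`, then `p` and `g p` are both centers of the same triple `z`. For each `a`,
`d(p, g p) = (z a|g p)_p + (z a|p)_{g p}`, and each term is large for at most one `a`, so some `a`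
bounds both.

Uniform perfectness: go distance `t` from `w` towards `ξ`, to a point `p`. Some `ζ` of the triple at
`p` is, seen from `p`, away from both `w` and `ξ`, so `(ξ|ζ)_w` is `t` up to a constant. Frink's
lemma turns this into a statement about the visual metric. -/

/-! ### Gromov products in arbitrary metric spaces. -/

section GromovProduct

variable {X : Type*} [MetricSpace X]

theorem gromovProduct_comm (w x y : X) : gromovProduct w x y = gromovProduct w y x := by
  unfold gromovProduct; rw [dist_comm x y]; ring

theorem gromovProduct_nonneg (w x y : X) : 0 ≤ gromovProduct w x y := by
  unfold gromovProduct
  have := dist_triangle x w y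
  rw [dist_comm w y] at this
  linarith

theorem gromovProduct_self (w x : X) : gromovProduct w x x = dist x w := by
  unfold gromovProduct; rw [dist_self]; ring

theorem gromovProduct_le_dist_left (w x y : X) : gromovProduct w x y ≤ dist x w := by
  unfold gromovProduct
  have := dist_triangle y x w
  rw [dist_comm y x] at this
  linarith

theorem gromovProduct_add_gromovProduct (w x y : X) :
    gromovProduct w x y + gromovProduct x w y = dist x w := by
  unfold gromovProduct; rw [dist_comm w x, dist_comm y x, dist_comm y w]; ring

theorem gromovProduct_le_add_dist (w w' x y : X) :
    gromovProduct w x y ≤ gromovProduct w' x y + dist w w' := by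
  unfold gromovProduct
  have h₁ := dist_triangle x w' w
  have h₂ := dist_triangle y w' w
  rw [dist_comm w' w] at h₁ h₂
  linarith

theorem gromovProduct_le_of_dist_le {w w' x x' y y' : X} {r : ℝ} (hw : dist w w' ≤ r)
    (hx : dist x x' ≤ r) (hy : dist y y' ≤ r) :
    gromovProduct w x y ≤ gromovProduct w' x' y' + 3 * r := by
  unfold gromovProduct
  have h₁ := dist_triangle4 x x' w' w
  have h₂ := dist_triangle4 y y' w' w
  have h₃ := dist_triangle4 x' x y y'
  rw [dist_comm w' w] at h₁ h₂
  rw [dist_comm x' x] at h₃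
  linarith

/-- The Gromov product is at most the distance to any point between `x` and `y`. -/
theorem gromovProduct_le_dist_of_between {w x y m : X} (hm : dist x m + dist m y = dist x y) :
    gromovProduct w x y ≤ dist w m := by
  unfold gromovProduct
  have h₁ := dist_triangle x m w
  have h₂ := dist_triangle y m w
  rw [dist_comm m w] at h₁ h₂
  rw [dist_comm y m] at h₂
  linarith

end GromovProduct

/-! ### Geodesic segments. -/

section Geodesics

variable {X : Type*} [MetricSpace X]

theorem isGeodesicSegment_image_Icc {γ : ℝ → X} {a b : ℝ}
    (hγ : ∀ s ∈ Set.Icc a b, ∀ t ∈ Set.Icc a b, dist (γ s) (γ t) = |s - t|) {u v : ℝ}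
    (hu : a ≤ u) (huv : u ≤ v) (hv : v ≤ b) :
    IsGeodesicSegment (γ u) (γ v) (γ '' Set.Icc u v) := by
  have hd : dist (γ u) (γ v) = v - u := by
    rw [hγ u ⟨hu, huv.trans hv⟩ v ⟨hu.trans huv, hv⟩, abs_sub_comm, abs_of_nonneg (by linarith)]
  refine ⟨fun t => γ (u + t), ⟨by simp, by simp [hd], ?_⟩, ?_⟩
  · rintro s ⟨hs₀, hs₁⟩ t ⟨ht₀, ht₁⟩
    rw [hd] at hs₁ ht₁
    rw [hγ _ ⟨by linarith, by linarith⟩ _ ⟨by linarith, by linarith⟩]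
    congr 1; ring
  · rw [hd]
    ext z
    constructor
    · rintro ⟨s, ⟨h₁, h₂⟩, rfl⟩
      exact ⟨s - u, ⟨by linarith, by linarith⟩, by simp⟩
    · rintro ⟨s, ⟨h₁, h₂⟩, rfl⟩
      exact ⟨u + s, ⟨by linarith, by linarith⟩, rfl⟩

theorem IsGeodesicSegment.symm {x y : X} {s : Set X} (h : IsGeodesicSegment x y s) :
    IsGeodesicSegment y x s := by
  obtain ⟨γ, ⟨h0, h1, hγ⟩, rfl⟩ := h
  refine ⟨fun t => γ (dist x y - t), ⟨by simpa using h1, by simpa [dist_comm y x] using h0, ?_⟩, ?_⟩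
  · rintro s ⟨hs₀, hs₁⟩ t ⟨ht₀, ht₁⟩
    rw [dist_comm y x] at hs₁ ht₁
    rw [hγ _ ⟨by linarith, by linarith⟩ _ ⟨by linarith, by linarith⟩, abs_sub_comm]
    congr 1; ring
  · rw [dist_comm y x]
    ext z
    constructor
    · rintro ⟨s, ⟨h₁, h₂⟩, rfl⟩
      exact ⟨dist x y - s, ⟨by linarith, by linarith⟩, by simp⟩
    · rintro ⟨s, ⟨h₁, h₂⟩, rfl⟩
      exact ⟨dist x y - s, ⟨by linarith, by linarith⟩, rfl⟩

theorem IsGeodesicSegment.exists_dist_eq {x y : X} {s : Set X} (h : IsGeodesicSegment x y s)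
    {t : ℝ} (ht₀ : 0 ≤ t) (ht₁ : t ≤ dist x y) : ∃ m ∈ s, dist x m = t := by
  obtain ⟨γ, ⟨h0, h1, hγ⟩, rfl⟩ := h
  refine ⟨γ t, ⟨t, ⟨ht₀, ht₁⟩, rfl⟩, ?_⟩
  conv_lhs => rw [← h0]
  rw [hγ 0 ⟨le_rfl, dist_nonneg⟩ t ⟨ht₀, ht₁⟩, abs_sub_comm, sub_zero, abs_of_nonneg ht₀]

theorem IsGeodesicSegment.dist_add_dist {x y m : X} {s : Set X} (h : IsGeodesicSegment x y s)
    (hm : m ∈ s) : dist x m + dist m y = dist x y := by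
  obtain ⟨γ, ⟨h0, h1, hγ⟩, rfl⟩ := h
  obtain ⟨t, ⟨ht₀, ht₁⟩, rfl⟩ := hm
  have e₁ := hγ 0 ⟨le_rfl, dist_nonneg⟩ t ⟨ht₀, ht₁⟩
  have e₂ := hγ t ⟨ht₀, ht₁⟩ _ ⟨dist_nonneg, le_rfl⟩
  rw [h0, abs_sub_comm, sub_zero, abs_of_nonneg ht₀] at e₁
  rw [h1, abs_sub_comm, abs_of_nonneg (by linarith)] at e₂
  linarith

theorem IsGeodesicSegment.gromovProduct_le {x y m : X} {s : Set X} (h : IsGeodesicSegment x y s)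
    (hm : m ∈ s) (w : X) : gromovProduct w x y ≤ dist w m :=
  gromovProduct_le_dist_of_between (h.dist_add_dist hm)

end Geodesics

/-! ### Slim triangles, thin triangles and the four-point condition. -/

section Hyperbolic

variable {X : Type*} [MetricSpace X]

/-- On a geodesic `[x, y]`, the point at distance `(w|y)_x` from `x` realizes `(x|y)_w` up to
`2δ`. -/
theorem IsDeltaHyperbolic.dist_le_gromovProduct_add {δ : ℝ} (hX : IsDeltaHyperbolic X δ)
    (hg : IsGeodesicSpace X) {w x y m : X} {s : Set X} (hs : IsGeodesicSegment x y s)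
    (hm : m ∈ s) (hxm : dist x m = gromovProduct x w y) :
    dist w m ≤ gromovProduct w x y + 2 * δ := by
  obtain ⟨b, hb⟩ := hg y w
  obtain ⟨c, hc⟩ := hg w x
  obtain ⟨q, hq, hmq⟩ := hX x y w s b c hs hb hc m hm
  have hm' := hs.dist_add_dist hm
  have h₁ := dist_triangle w q m
  unfold gromovProduct at *
  rw [dist_comm w x, dist_comm y x, dist_comm w y] at hxm
  rw [dist_comm m q] at hmq
  rcases hq with hq | hq
  · have h₂ := hb.dist_add_dist hq
    have h₃ := dist_triangle m q y
    rw [dist_comm w q] at h₁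
    rw [dist_comm m q, dist_comm q y] at h₃
    linarith
  · have h₂ := hc.dist_add_dist hq
    have h₃ := dist_triangle x q m
    rw [dist_comm x q] at h₃
    rw [dist_comm w x] at h₂
    linarith

theorem IsDeltaHyperbolic.exists_mem_dist_le {δ : ℝ} (hX : IsDeltaHyperbolic X δ)
    (hg : IsGeodesicSpace X) (w : X) {x y : X} {s : Set X} (hs : IsGeodesicSegment x y s) :
    ∃ m ∈ s, dist w m ≤ gromovProduct w x y + 2 * δ := by
  obtain ⟨m, hm, hxm⟩ := hs.exists_dist_eq (t := gromovProduct x w y) (gromovProduct_nonneg _ _ _)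
    (by rw [gromovProduct_comm, dist_comm]; exact gromovProduct_le_dist_left _ _ _)
  exact ⟨m, hm, hX.dist_le_gromovProduct_add hg hs hm hxm⟩

/-- The four-point condition `min ((x|y)_w) ((y|z)_w) - δ ≤ (x|z)_w`. -/
def FourPointHyperbolic (X : Type*) [MetricSpace X] (δ : ℝ) : Prop :=
  ∀ w x y z : X, min (gromovProduct w x y) (gromovProduct w y z) ≤ gromovProduct w x z + δ

/-- A point of `[x, z]` realizing `(x|z)_w` up to `2 * δ` is `δ`-close to another side, and the
distance from `w` to any point of a side bounds that side's product. -/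
theorem IsDeltaHyperbolic.fourPointHyperbolic {δ : ℝ} (hX : IsDeltaHyperbolic X δ)
    (hg : IsGeodesicSpace X) : FourPointHyperbolic X (3 * δ) := by
  intro w x y z
  obtain ⟨a, ha⟩ := hg x z
  obtain ⟨b, hb⟩ := hg z y
  obtain ⟨c, hc⟩ := hg y x
  obtain ⟨m, hm, hwm⟩ := hX.exists_mem_dist_le hg w ha
  obtain ⟨q, hq, hmq⟩ := hX x z y a b c ha hb hc m hm
  have h := dist_triangle w m q
  rcases hq with hq | hq
  · have := hb.symm.gromovProduct_le hq w
    exact (min_le_right _ _).trans (by linarith)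
  · have := hc.symm.gromovProduct_le hq w
    exact (min_le_left _ _).trans (by linarith)

/-- Shortcut from `x` to `z` through the points at height `t` on the three geodesics from `w`. The
constant is `δ` itself, as the range `ε < 1 / (5 * δ)` of visual parameters requires. -/
theorem HasThinTriangles.fourPointHyperbolic {δ : ℝ} (hX : HasThinTriangles X δ)
    (hg : IsGeodesicSpace X) : FourPointHyperbolic X δ := by
  intro w x y z
  obtain ⟨_, α, hα, -⟩ := hg w x
  obtain ⟨_, β, hβ, -⟩ := hg w y
  obtain ⟨_, γ, hγ, -⟩ := hg w z
  set t := min (gromovProduct w x y) (gromovProduct w y z) with ht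
  have ht₀ : 0 ≤ t := le_min (gromovProduct_nonneg _ _ _) (gromovProduct_nonneg _ _ _)
  have h₁ := hX w x y α β hα hβ t ht₀ (min_le_left _ _)
  have h₂ := hX w y z β γ hβ hγ t ht₀ (min_le_right _ _)
  have key : ∀ (v : X) (σ : ℝ → X), IsGeodesicFromTo σ w v → t ≤ dist v w →
      dist v (σ t) = dist v w - t := by
    rintro v σ ⟨-, h1, hσ⟩ htv
    rw [dist_comm v w] at htv ⊢
    have := hσ _ ⟨dist_nonneg, le_rfl⟩ t ⟨ht₀, htv⟩
    rwa [h1, abs_of_nonneg (by linarith)] at this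
  have h₃ := key x α hα ((min_le_left _ _).trans (gromovProduct_le_dist_left _ _ _))
  have h₄ := key z γ hγ ((min_le_right _ _).trans
    (by rw [gromovProduct_comm]; exact gromovProduct_le_dist_left _ _ _))
  have h₅ := dist_triangle4 x (α t) (γ t) z
  have h₆ := dist_triangle (α t) (β t) (γ t)
  rw [dist_comm (γ t) z] at h₅
  unfold gromovProduct
  linarith

theorem FourPointHyperbolic.le_max {δ : ℝ} (h : FourPointHyperbolic X δ) {w x y z : X} {r : ℝ}
    (hxz : gromovProduct w x z ≤ r) (hyz : r + δ < gromovProduct w y z) :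
    gromovProduct w x y ≤ r + δ := by
  by_contra! hc
  have := h w x y z
  have := lt_min hc hyz
  linarith

/-- If both arguments are replaced by points which are close to them as seen from `w`, then the
Gromov product changes by a bounded amount. -/
theorem FourPointHyperbolic.gromovProduct_le_of_lt {δ : ℝ} (h : FourPointHyperbolic X δ)
    {w x x' y y' : X} {r : ℝ} (hxy : gromovProduct w x y ≤ r)
    (hx : r + 2 * δ < gromovProduct w x x') (hy : r + δ < gromovProduct w y y') :
    gromovProduct w x' y' ≤ r + 2 * δ := by
  -- `y` is replaced first; `x` must then beat a bound already raised by `δ`.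
  have h₁ : gromovProduct w x y' ≤ r + δ :=
    h.le_max hxy (by rwa [gromovProduct_comm w y' y])
  have h₂ : gromovProduct w y' x' ≤ r + δ + δ :=
    h.le_max (z := x) (by rwa [gromovProduct_comm w y' x])
      (by rw [gromovProduct_comm w x' x]; linarith)
  rw [gromovProduct_comm]
  linarith

/-- Seen from `p`, each of two points is close to at most one of three points that are pairwise
far from each other. -/
theorem FourPointHyperbolic.exists_gromovProduct_le {δ D : ℝ} (h : FourPointHyperbolic X δ)
    {p p' : X} {z : Fin 3 → X} (hp : ∀ a b, a ≠ b → gromovProduct p (z a) (z b) ≤ D)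
    (hp' : ∀ a b, a ≠ b → gromovProduct p' (z a) (z b) ≤ D) (u v : X) :
    ∃ a, gromovProduct p (z a) u ≤ D + δ ∧ gromovProduct p' (z a) v ≤ D + δ := by
  have key : ∀ (o c : X), (∀ a b, a ≠ b → gromovProduct o (z a) (z b) ≤ D) → ∀ a b, a ≠ b →
      gromovProduct o (z a) c ≤ D + δ ∨ gromovProduct o (z b) c ≤ D + δ := by
    intro o c ho a b hab
    by_contra! hc
    have h₁ := h o (z a) c (z b)
    rw [gromovProduct_comm o c (z b)] at h₁
    have h₂ := lt_min hc.1 hc.2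
    linarith [ho a b hab]
  have h₁ := key p u hp
  have h₂ := key p' v hp'
  by_contra! hc
  have c0 := hc 0
  have c1 := hc 1
  have c2 := hc 2
  have a01 := h₁ 0 1 (by decide)
  have a02 := h₁ 0 2 (by decide)
  have a12 := h₁ 1 2 (by decide)
  have b01 := h₂ 0 1 (by decide)
  have b02 := h₂ 0 2 (by decide)
  have b12 := h₂ 1 2 (by decide)
  simp only [← not_le] at c0 c1 c2
  tauto

end Hyperbolic

/-! ### Stability of quasi-geodesics and its effect on Gromov products. -/

section Stability

variable {X Y : Type*} [MetricSpace X] [MetricSpace Y]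

/-- Exponential divergence: a geodesic is logarithmically close to any chain joining its
endpoints. -/
theorem IsDeltaHyperbolic.exists_dist_chain_le {δ : ℝ} (hX : IsDeltaHyperbolic X δ)
    (hg : IsGeodesicSpace X) {b : ℕ → X} {h : ℝ} (hh : 0 ≤ h)
    (hb : ∀ l, dist (b l) (b (l + 1)) ≤ h) (k : ℕ) :
    ∀ i j : ℕ, i ≤ j → j ≤ i + 2 ^ k → ∀ s : Set X, IsGeodesicSegment (b i) (b j) s → ∀ m ∈ s,
      ∃ l, dist m (b l) ≤ k * δ + h := by
  induction k with
  | zero =>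
    intro i j hij hj s hs m hm
    refine ⟨i, ?_⟩
    have h₁ := hs.dist_add_dist hm
    have h₂ : dist (b i) (b j) ≤ h := by
      obtain rfl | rfl : j = i ∨ j = i + 1 := by rw [pow_zero] at hj; omega
      · rwa [dist_self]
      · exact hb _
    rw [dist_comm]
    have := dist_nonneg (x := m) (y := b j)
    simp only [Nat.cast_zero, zero_mul, zero_add]
    linarith
  | succ k ih =>
    intro i j hij hj s hs m hm
    rw [pow_succ] at hj
    -- Bisect the chain: each level of bisection costs one `δ`.
    obtain ⟨n, hin, hnj, hn, hjn⟩ : ∃ n, i ≤ n ∧ n ≤ j ∧ n ≤ i + 2 ^ k ∧ j ≤ n + 2 ^ k :=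
      ⟨min j (i + 2 ^ k), by omega, by omega, by omega, by omega⟩
    obtain ⟨a, ha⟩ := hg (b j) (b n)
    obtain ⟨c, hc⟩ := hg (b n) (b i)
    obtain ⟨q, hq, hmq⟩ := hX _ _ _ s a c hs ha hc m hm
    obtain ⟨l, hl⟩ : ∃ l, dist q (b l) ≤ k * δ + h := by
      rcases hq with hq | hq
      · exact ih n j hnj hjn a ha.symm q hq
      · exact ih i n hin hn c hc.symm q hq
    refine ⟨l, ?_⟩
    have := dist_triangle m q (b l)
    push_cast
    linarith

theorem IsDeltaHyperbolic.exists_dist_path_le {δ : ℝ} (hX : IsDeltaHyperbolic X δ)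
    (hg : IsGeodesicSpace X) {c : ℝ → X} {h L : ℝ}
    (hc : ∀ s ∈ Set.Icc 0 L, ∀ t ∈ Set.Icc 0 L, |s - t| ≤ 1 → dist (c s) (c t) ≤ h) {k : ℕ}
    {u v : ℝ} (hu : u ∈ Set.Icc 0 L) (hv : v ∈ Set.Icc 0 L) (huv : |u - v| ≤ 2 ^ k) {s : Set X}
    (hs : IsGeodesicSegment (c u) (c v) s) {m : X} (hm : m ∈ s) :
    ∃ t ∈ Set.Icc 0 L, dist m (c t) ≤ k * δ + h := by
  wlog hle : u ≤ v generalizing u v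
  · exact this hv hu (by rwa [abs_sub_comm]) hs.symm (le_of_not_ge hle)
  -- Sample at unit times, frozen once `v` is reached; no continuity of `c` is involved.
  have hmem : ∀ l : ℕ, min (u + l) v ∈ Set.Icc 0 L := fun l =>
    ⟨le_min (add_nonneg hu.1 l.cast_nonneg) hv.1, (min_le_right _ _).trans hv.2⟩
  have hh : 0 ≤ h := dist_nonneg.trans (hc u hu u hu (by simp))
  have hb : ∀ l : ℕ, dist (c (min (u + l) v)) (c (min (u + (l + 1 : ℕ)) v)) ≤ h := by
    intro l
    refine hc _ (hmem l) _ (hmem _) ?_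
    refine (abs_min_sub_min_le_max _ _ _ _).trans ?_
    simp
  obtain ⟨l, hl⟩ := hX.exists_dist_chain_le hg (b := fun l : ℕ => c (min (u + l) v)) hh hb k
    0 (2 ^ k) (Nat.zero_le _) (by simp) s (by
      rw [abs_sub_comm, abs_of_nonneg (by linarith)] at huv
      have h₁ : min (u + ((0 : ℕ) : ℝ)) v = u := by simpa using hle
      have h₂ : min (u + ((2 ^ k : ℕ) : ℝ)) v = v := by
        rw [min_eq_right]; push_cast; linarith
      simpa only [h₁, h₂] using hs) m hm
  exact ⟨_, hmem l, hl⟩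

theorem exists_forall_linear_lt_two_pow (A B : ℝ) : ∃ k₀ : ℕ, ∀ k ≥ k₀, A * k + B < 2 ^ k := by
  have h₁ := tendsto_pow_const_div_const_pow_of_one_lt 1 (r := (2 : ℝ)) (by norm_num)
  have h₂ := tendsto_pow_const_div_const_pow_of_one_lt 0 (r := (2 : ℝ)) (by norm_num)
  have h₃ := ((h₁.const_mul A).add (h₂.const_mul B)).eventually_lt_const
    (show A * 0 + B * 0 < 1 by norm_num)
  obtain ⟨k₀, hk₀⟩ := eventually_atTop.1 h₃
  refine ⟨k₀, fun k hk => ?_⟩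
  have h₄ := hk₀ k hk
  have : (0 : ℝ) < 2 ^ k := by positivity
  rw [← mul_div_assoc, ← mul_div_assoc, ← add_div, div_lt_one this] at h₄
  simpa using h₄

/-- Cut along a diagonal and use slimness twice. If `v` falls on a lateral side, only its distance
to the end of that side is kept. -/
theorem IsDeltaHyperbolic.exists_dist_quadrilateral_le {δ : ℝ} (hδ : 0 ≤ δ)
    (hX : IsDeltaHyperbolic X δ) (hg : IsGeodesicSpace X) {y z a b m : X} {s e : Set X}
    (hs : IsGeodesicSegment y z s) (he : IsGeodesicSegment a b e) (hm : m ∈ s) :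
    ∃ v, dist m v ≤ 2 * δ ∧ (v ∈ e ∨ dist y v ≤ dist y a ∨ dist z v ≤ dist z b) := by
  obtain ⟨e₁, he₁⟩ := hg z a
  obtain ⟨e₂, he₂⟩ := hg a y
  obtain ⟨e₃, he₃⟩ := hg b z
  obtain ⟨q, hq, hmq⟩ := hX _ _ _ s e₁ e₂ hs he₁ he₂ m hm
  rcases hq with hq | hq
  · obtain ⟨v, hv, hqv⟩ := hX _ _ _ e₁ e e₃ he₁ he he₃ q hq
    refine ⟨v, by linarith [dist_triangle m q v], ?_⟩
    rcases hv with hv | hv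
    · exact Or.inl hv
    · have := he₃.symm.dist_add_dist hv
      exact Or.inr (Or.inr (by linarith [dist_nonneg (x := v) (y := b)]))
  · have := he₂.symm.dist_add_dist hq
    exact ⟨q, by linarith, Or.inr (Or.inl (by linarith [dist_nonneg (x := q) (y := a)]))⟩

/-- A geodesic is uniformly close to every quasi-geodesic with the same endpoints. -/
theorem IsDeltaHyperbolic.exists_dist_quasigeodesic_le {δ : ℝ} (hδ : 0 ≤ δ)
    (hX : IsDeltaHyperbolic X δ) (hg : IsGeodesicSpace X) {K C : ℝ} (hK : 1 ≤ K) (hC : 0 ≤ C) :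
    ∃ R : ℝ, ∀ L : ℝ, 0 ≤ L → ∀ c : ℝ → X,
      (∀ s ∈ Set.Icc 0 L, ∀ t ∈ Set.Icc 0 L,
        K⁻¹ * |s - t| - C ≤ dist (c s) (c t) ∧ dist (c s) (c t) ≤ K * |s - t| + C) →
      ∀ e : Set X, IsGeodesicSegment (c 0) (c L) e → ∀ m ∈ e,
        ∃ t ∈ Set.Icc 0 L, dist m (c t) ≤ R := by
  -- Chosen to contradict `2 ^ k ≤ 2 * (N + 1)` below, where `N` is bounded linearly in `k`.
  obtain ⟨k₀, hk₀⟩ := exists_forall_linear_lt_two_pow (12 * K * δ)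
    (2 * (K * (6 * (2 * δ + K + C) + 2 + C)) + 2)
  refine ⟨k₀ * δ + 2 * δ + K + C + 2, fun L hL c hc e he m hm => ?_⟩
  have hK₀ : 0 < K := by linarith
  obtain ⟨σ, ⟨hσ₀, hσ₁, hσ⟩, rfl⟩ := he
  set l := dist (c 0) (c L) with hl
  have hl₀ : 0 ≤ l := dist_nonneg
  set S := c '' Set.Icc 0 L with hS
  have hSne : S.Nonempty := ⟨c 0, 0, ⟨le_rfl, hL⟩, rfl⟩
  have hσc : ContinuousOn σ (Set.Icc 0 l) := by
    have : LipschitzOnWith 1 σ (Set.Icc 0 l) := LipschitzOnWith.of_dist_le_mul fun s hs t ht => by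
      rw [hσ s hs t ht, Real.dist_eq]; simp
    exact this.continuousOn
  -- `σ u₀` is the point of the geodesic farthest from the path; its distance `D` must be bounded.
  obtain ⟨u₀, hu₀, hmax⟩ := isCompact_Icc.exists_isMaxOn (Set.nonempty_Icc.2 hl₀)
    ((Metric.continuous_infDist_pt S).comp_continuousOn hσc)
  set D := Metric.infDist (σ u₀) S with hD
  have hD₀ : 0 ≤ D := Metric.infDist_nonneg
  have hle : ∀ u ∈ Set.Icc 0 l, Metric.infDist (σ u) S ≤ D := fun u hu => hmax hu
  have hnear : ∀ u ∈ Set.Icc 0 l, ∀ r, D < r → ∃ t ∈ Set.Icc 0 L, dist (σ u) (c t) < r := by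
    intro u hu r hr
    obtain ⟨-, ⟨t, ht, rfl⟩, h⟩ := (Metric.infDist_lt_iff hSne).1 ((hle u hu).trans_lt hr)
    exact ⟨t, ht, h⟩
  have hDle : ∀ t ∈ Set.Icc 0 L, D ≤ dist (σ u₀) (c t) := fun t ht =>
    Metric.infDist_le_dist_of_mem ⟨t, ht, rfl⟩
  suffices hDR : D ≤ k₀ * δ + 2 * δ + K + C + 1 by
    obtain ⟨u, hu, rfl⟩ := hm
    obtain ⟨t, ht, h⟩ := hnear u hu (k₀ * δ + 2 * δ + K + C + 2) (by linarith)
    exact ⟨t, ht, h.le⟩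
  -- a bounded excursion from `σ u₀` along the geodesic, followed by a jump to the path
  have hfar : ∀ u ∈ Set.Icc 0 l, |u₀ - u| = 2 * D → ∃ t ∈ Set.Icc 0 L,
      dist (σ u) (c t) ≤ D + 1 ∧ ∀ v, dist (σ u) v ≤ dist (σ u) (c t) →
        dist (σ u₀) v ≤ 2 * δ → D ≤ 1 + 2 * δ := by
    intro u hu hud
    obtain ⟨t, ht, hut⟩ := hnear u hu (D + 1) (by linarith)
    refine ⟨t, ht, hut.le, fun v h₁ h₂ => ?_⟩
    have := dist_triangle_right (σ u₀) (σ u) v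
    rw [hσ u₀ hu₀ u hu, hud] at this
    linarith
  -- If the geodesic ends within `2 * D`, its endpoint already lies on the path and the jump is
  -- trivial.
  have hend : ∀ (u t : ℝ), t ∈ Set.Icc 0 L → σ u = c t → dist (σ u) (c t) ≤ D + 1 ∧
      ∀ v, dist (σ u) v ≤ dist (σ u) (c t) → dist (σ u₀) v ≤ 2 * δ → D ≤ 1 + 2 * δ := by
    intro u t ht h
    rw [h, dist_self]
    refine ⟨by linarith, fun v h₁ h₂ => ?_⟩
    obtain rfl := dist_le_zero.1 h₁
    linarith [hDle t ht]
  obtain ⟨u₁, hu₁, hu₁₀, hu₁D, t₁, ht₁, hut₁, hv₁⟩ : ∃ u₁ ∈ Set.Icc 0 l, u₁ ≤ u₀ ∧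
      u₀ - u₁ ≤ 2 * D ∧ ∃ t ∈ Set.Icc 0 L, dist (σ u₁) (c t) ≤ D + 1 ∧
      ∀ v, dist (σ u₁) v ≤ dist (σ u₁) (c t) → dist (σ u₀) v ≤ 2 * δ → D ≤ 1 + 2 * δ := by
    by_cases h : 2 * D ≤ u₀
    · refine ⟨u₀ - 2 * D, ⟨by linarith, by linarith [hu₀.2]⟩, by linarith, by linarith,
        hfar _ ⟨by linarith, by linarith [hu₀.2]⟩ ?_⟩
      rw [sub_sub_cancel, abs_of_nonneg (by linarith)]
    · exact ⟨0, ⟨le_rfl, hl₀⟩, hu₀.1, by linarith, 0, ⟨le_rfl, hL⟩, hend 0 0 ⟨le_rfl, hL⟩ hσ₀⟩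
  obtain ⟨u₂, hu₂, hu₂₀, hu₂D, t₂, ht₂, hut₂, hv₂⟩ : ∃ u₂ ∈ Set.Icc 0 l, u₀ ≤ u₂ ∧
      u₂ - u₀ ≤ 2 * D ∧ ∃ t ∈ Set.Icc 0 L, dist (σ u₂) (c t) ≤ D + 1 ∧
      ∀ v, dist (σ u₂) v ≤ dist (σ u₂) (c t) → dist (σ u₀) v ≤ 2 * δ → D ≤ 1 + 2 * δ := by
    by_cases h : u₀ + 2 * D ≤ l
    · refine ⟨u₀ + 2 * D, ⟨by linarith [hu₀.1], h⟩, by linarith, by linarith,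
        hfar _ ⟨by linarith [hu₀.1], h⟩ ?_⟩
      rw [abs_sub_comm, add_sub_cancel_left, abs_of_nonneg (by linarith)]
    · exact ⟨l, ⟨hl₀, le_rfl⟩, hu₀.2, by linarith, L, ⟨hL, le_rfl⟩, hend l L ⟨hL, le_rfl⟩ hσ₁⟩
  have hseg := isGeodesicSegment_image_Icc hσ hu₁.1 (hu₁₀.trans hu₂₀) hu₂.2
  obtain ⟨e', he'⟩ := hg (c t₁) (c t₂)
  obtain ⟨v, hmv, hv⟩ := hX.exists_dist_quadrilateral_le hδ hg hseg he'
    (m := σ u₀) ⟨u₀, ⟨hu₁₀, hu₂₀⟩, rfl⟩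
  have hk₀δ : 0 ≤ (k₀ : ℝ) * δ := by positivity
  rcases hv with hv | hv | hv
  -- Two jumps of `D + 1` and a geodesic piece of `4 * D` give `6 * D + 2`. The path between `t₁`
  -- and `t₂` thus has duration linear in `D`, so `D` is at most logarithmic in itself.
  · set N := K * (6 * D + 2 + C) with hN
    have hN₂ : 2 ≤ N := by nlinarith
    have htt : |t₁ - t₂| ≤ N := by
      have h₁ := (hc t₁ ht₁ t₂ ht₂).1
      have h₂ := dist_triangle4 (c t₁) (σ u₁) (σ u₂) (c t₂)
      rw [hσ u₁ hu₁ u₂ hu₂, abs_sub_comm u₁, abs_of_nonneg (by linarith : 0 ≤ u₂ - u₁),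
        dist_comm (c t₁) (σ u₁)] at h₂
      have h₃ : K⁻¹ * |t₁ - t₂| ≤ 6 * D + 2 + C := by linarith
      rwa [inv_mul_le_iff₀ hK₀] at h₃
    set k := Nat.clog 2 ⌈N⌉₊ with hk
    have hceil : 1 < ⌈N⌉₊ := Nat.lt_ceil.2 (by push_cast; linarith)
    have hNk : N ≤ 2 ^ k := (Nat.le_ceil N).trans
      (by exact_mod_cast Nat.le_pow_clog (b := 2) (by norm_num) ⌈N⌉₊)
    have hkN : (2 : ℝ) ^ k ≤ 2 * (N + 1) := by
      have h₁ : 2 ^ (k - 1) < ⌈N⌉₊ := Nat.pow_pred_clog_lt_self (by norm_num) hceil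
      have h₂ : ((2 ^ (k - 1) : ℕ) : ℝ) < N + 1 :=
        (Nat.cast_lt.2 h₁).trans (Nat.ceil_lt_add_one (by linarith))
      have h₃ : 0 < k := Nat.clog_pos (by norm_num) hceil
      have h₄ : (2 : ℝ) ^ k = 2 * 2 ^ (k - 1) := by
        rw [← pow_succ', Nat.sub_add_cancel h₃]
      push_cast at h₂
      rw [h₄]; linarith
    obtain ⟨t, ht, hvt⟩ := hX.exists_dist_path_le hg (h := K + C)
      (fun s hs t ht hst => (hc s hs t ht).2.trans (by nlinarith)) ht₁ ht₂ (htt.trans hNk) he' hv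
    have hDk : D ≤ k * δ + 2 * δ + K + C := by
      have := hDle t ht
      have := dist_triangle (σ u₀) v (c t)
      linarith
    have hkk : k < k₀ := by
      by_contra! hkk
      have h₁ := hk₀ k hkk
      have h₂ : K * (6 * D + 2 + C) ≤ K * (6 * (k * δ + 2 * δ + K + C) + 2 + C) := by gcongr
      have h₃ : K * (6 * (k * δ + 2 * δ + K + C) + 2 + C) =
        6 * K * δ * k + K * (6 * (2 * δ + K + C) + 2 + C) := by ring
      linarith
    have : (k : ℝ) * δ ≤ k₀ * δ := by gcongr
    linarith
  · linarith [hv₁ v hv hmv]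
  · linarith [hv₂ v hv hmv]

/-- A quasi-isometric embedding coarsely increases Gromov products. -/
theorem IsQIEmbeddingWith.exists_gromovProduct_le {δ : ℝ} (hδ : 0 ≤ δ)
    (hY : IsDeltaHyperbolic Y δ) (hXg : IsGeodesicSpace X) (hYg : IsGeodesicSpace Y)
    {K C : ℝ} (hK : 1 ≤ K) (hC : 0 ≤ C) {f : X → Y} (hf : IsQIEmbeddingWith K C f) :
    ∃ A B : ℝ, 0 < A ∧
      ∀ p x y, gromovProduct p x y ≤ A * gromovProduct (f p) (f x) (f y) + B := by
  have hK₀ : 0 < K := by linarith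
  obtain ⟨R, hR⟩ := hY.exists_dist_quasigeodesic_le hδ hYg hK hC
  refine ⟨K, K * (2 * δ + R + C), hK₀, fun p x y => ?_⟩
  obtain ⟨s, hs⟩ := hXg x y
  obtain ⟨γ, ⟨h0, h1, hγ⟩, rfl⟩ := id hs
  obtain ⟨e, he⟩ := hYg (f x) (f y)
  -- The product at `f p` is nearly realized by a point of the geodesic, which is close to the image
  -- of `[x, y]`.
  obtain ⟨m, hm, hpm⟩ := hY.exists_mem_dist_le hYg (f p) he
  obtain ⟨t, ht, hmt⟩ := hR (dist x y) dist_nonneg (f ∘ γ)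
    (fun s hs t ht => by rw [← hγ s hs t ht]; exact hf _ _) e
    (by simpa only [Function.comp, h0, h1] using he) m hm
  have h₁ := hs.gromovProduct_le ⟨t, ht, rfl⟩ p
  have h₂ := (hf p (γ t)).1
  have h₃ := dist_triangle (f p) m (f (γ t))
  have h₄ : K⁻¹ * dist p (γ t) ≤
      gromovProduct (f p) (f x) (f y) + (2 * δ + R + C) := by
    simp only [Function.comp] at hmt
    linarith
  rw [inv_mul_le_iff₀ hK₀] at h₄
  linarith

/-- Quasi-isometries coarsely preserve Gromov products; this is the upper bound. -/
theorem IsQuasiIsometry.exists_gromovProduct_le {δ : ℝ} (hδ : 0 ≤ δ)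
    (hX : IsDeltaHyperbolic X δ) (hXg : IsGeodesicSpace X) (hYg : IsGeodesicSpace Y)
    {g : X → Y} (hg : IsQuasiIsometry g) :
    ∃ A B : ℝ, 0 < A ∧
      ∀ p x y, gromovProduct (g p) (g x) (g y) ≤ A * gromovProduct p x y + B := by
  obtain ⟨K, C, hK, hC, hKC, hsurj⟩ := hg
  have hK₀ : 0 < K := by linarith
  -- A quasi-inverse `h`: the preceding lower bound applied to `h` is the upper bound for `g`.
  choose h hh using hsurj
  have hqi : IsQIEmbeddingWith K (3 * K * C) h := by
    intro x y
    have h₁ := hKC (h x) (h y)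
    have h₂ := dist_triangle4 x (g (h x)) (g (h y)) y
    have h₃ := dist_triangle4 (g (h x)) x y (g (h y))
    rw [dist_comm (g (h y)) y] at h₂
    rw [dist_comm (g (h x)) x] at h₃
    have h₄ := hh x
    have h₅ := hh y
    constructor
    · have h₆ : K⁻¹ * (dist x y) ≤ K⁻¹ * (K * dist (h x) (h y) + 3 * C) := by
        gcongr; linarith
      have h₇ : K⁻¹ * (K * dist (h x) (h y) + 3 * C) = dist (h x) (h y) + K⁻¹ * (3 * C) := by
        field_simp
      have h₈ : K⁻¹ * (3 * C) ≤ K * (3 * C) := by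
        gcongr; exact (inv_le_one_of_one_le₀ hK).trans hK
      linarith
    · have h₆ : K⁻¹ * dist (h x) (h y) ≤ dist x y + 3 * C := by linarith
      rw [inv_mul_le_iff₀ hK₀] at h₆
      linarith
  obtain ⟨A, B, hA, hAB⟩ := hqi.exists_gromovProduct_le hδ hX hYg hXg hK (by positivity)
  have hhg : ∀ x, dist (h (g x)) x ≤ K * (2 * C) := by
    intro x
    have h₁ := (hKC (h (g x)) x).1
    have h₂ := hh (g x)
    rw [dist_comm] at h₂
    have h₃ : K⁻¹ * dist (h (g x)) x ≤ 2 * C := by linarith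
    rwa [inv_mul_le_iff₀ hK₀] at h₃
  refine ⟨A, A * (3 * (K * (2 * C))) + B, hA, fun p x y => ?_⟩
  have h₁ := hAB (g p) (g x) (g y)
  have h₂ := gromovProduct_le_of_dist_le (hhg p) (hhg x) (hhg y)
  have h₃ := mul_le_mul_of_nonneg_left h₂ hA.le
  linarith

end Stability

/-! ### Gromov sequences and boundary points. -/

section Sequences

variable {X Y : Type*} [MetricSpace X] [MetricSpace Y]

theorem IsGromovSequence.exists_forall_lt {x : ℕ → X} (hx : IsGromovSequence x) (w : X) (B : ℝ) :
    ∃ N, ∀ i j, N ≤ i → N ≤ j → B < gromovProduct w (x i) (x j) :=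
  eventually_atTop_prod_self.1 ((hx w).eventually_gt_atTop B)

theorem IsGromovSequence.gromovEquivalent_self {x : ℕ → X} (hx : IsGromovSequence x) :
    GromovEquivalent x x := fun w =>
  tendsto_atTop.2 fun B => by
    obtain ⟨N, hN⟩ := hx.exists_forall_lt w B
    filter_upwards [eventually_ge_atTop N] with i hi using (hN i i hi hi).le

theorem GromovEquivalent.eventually_lt {x y : ℕ → X} (h : GromovEquivalent x y) (w : X) (B : ℝ) :
    ∀ᶠ i in atTop, B < gromovProduct w (x i) (y i) :=
  (h w).eventually_gt_atTop B

theorem GromovEquivalent.symm {x y : ℕ → X} (h : GromovEquivalent x y) : GromovEquivalent y x :=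
  fun w => by simpa only [gromovProduct_comm w (y _)] using h w

theorem GromovEquivalent.trans {δ : ℝ} (hX : FourPointHyperbolic X δ) {x y z : ℕ → X}
    (hxy : GromovEquivalent x y) (hyz : GromovEquivalent y z) : GromovEquivalent x z := fun w =>
  tendsto_atTop.2 fun B => by
    filter_upwards [hxy.eventually_lt w (B + δ), hyz.eventually_lt w (B + δ)] with i h₁ h₂
    have := hX w (x i) (y i) (z i)
    have := lt_min h₁ h₂
    linarith

/-- `Quot` only yields the generated equivalence relation; the four-point condition supplies
transitivity. -/
theorem GromovBoundary.gromovEquivalent_of_mk_eq {δ : ℝ} (hX : FourPointHyperbolic X δ)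
    {x y : ℕ → X} {hx : IsGromovSequence x} {hy : IsGromovSequence y}
    (h : GromovBoundary.mk x hx = GromovBoundary.mk y hy) : GromovEquivalent x y := by
  have key : ∀ a b : GromovSequence X, Relation.EqvGen
      (fun x y : GromovSequence X => GromovEquivalent x.1 y.1) a b → GromovEquivalent a.1 b.1 := by
    intro a b hab
    induction hab with
    | rel _ _ h => exact h
    | refl a => exact a.2.gromovEquivalent_self
    | symm _ _ _ ih => exact ih.symm
    | trans _ _ _ _ _ ih₁ ih₂ => exact ih₁.trans hX ih₂
  exact key _ _ (Quot.eqvGen_exact h)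

theorem GromovBoundary.exists_mk_eq (ξ : GromovBoundary X) :
    ∃ (x : ℕ → X) (hx : IsGromovSequence x), GromovBoundary.mk x hx = ξ := by
  induction ξ using Quot.ind with
  | mk a => exact ⟨a.1, a.2, rfl⟩

theorem not_isGromovSequence_of_dist_le {R : ℝ} (hR : ∀ x y : X, dist x y ≤ R) (x : ℕ → X) :
    ¬ IsGromovSequence x := fun hx => by
  obtain ⟨N, hN⟩ := hx.exists_forall_lt (x 0) R
  have := hN N N le_rfl le_rfl
  rw [gromovProduct_self] at this
  exact absurd (hR _ _) (not_le.2 this)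

theorem Isometry.gromovProduct_eq {γ : ℝ → X} (hγ : Isometry γ) (r s t : ℝ) :
    gromovProduct (γ r) (γ s) (γ t) = (|s - r| + |t - r| - |s - t|) / 2 := by
  simp only [gromovProduct, hγ.dist_eq, Real.dist_eq]

theorem Isometry.isGromovSequence {γ : ℝ → X} (hγ : Isometry γ) :
    IsGromovSequence fun n : ℕ => γ n := fun w =>
  tendsto_atTop.2 fun B => by
    obtain ⟨N, hN⟩ := exists_nat_ge (B + dist (γ 0) w)
    refine eventually_atTop_prod_self.2 ⟨N, fun i j hi hj => ?_⟩
    have h₁ := gromovProduct_le_add_dist (γ 0) w (γ i) (γ j)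
    rw [hγ.gromovProduct_eq, sub_zero, sub_zero, Nat.abs_cast, Nat.abs_cast] at h₁
    have hi' : (N : ℝ) ≤ i := Nat.cast_le.2 hi
    have hj' : (N : ℝ) ≤ j := Nat.cast_le.2 hj
    have h₂ : |(i : ℝ) - j| ≤ i + j - 2 * N := abs_sub_le_iff.2 ⟨by linarith, by linarith⟩
    dsimp only
    linarith

theorem Isometry.comp_neg {γ : ℝ → X} (hγ : Isometry γ) : Isometry fun t => γ (-t) :=
  hγ.comp (IsometryEquiv.neg ℝ).isometry

end Sequences

/-! ### Coarse centers: existence, pullback, boundary rigidity. -/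

section CoarseCenters

variable {X Y : Type*} [MetricSpace X] [MetricSpace Y]

/-- Every point is, up to the constant `D`, a center of an ideal triangle. -/
def HasCoarseCenters (X : Type*) [MetricSpace X] (D : ℝ) : Prop :=
  ∀ p : X, ∃ z : Fin 3 → ℕ → X, (∀ a, IsGromovSequence (z a)) ∧
    ∀ a b, a ≠ b → ∀ᶠ m in atTop, gromovProduct p (z a m) (z b m) ≤ D

/-- If a geodesic passes near `p` but far from `q`, then its ends are far from `q` as seen
from `p`. -/
theorem IsDeltaHyperbolic.gromovProduct_le_of_infDist {δ : ℝ} (hX : IsDeltaHyperbolic X δ)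
    (hg : IsGeodesicSpace X) {γ : ℝ → X} (hγ : Isometry γ) {p q : X} {r₁ r₂ s : ℝ}
    (hps : dist p (γ s) ≤ r₁)
    (hq : dist p q - r₂ ≤ Metric.infDist q (Set.range γ)) {t : ℝ} (hst : s ≤ t) :
    gromovProduct p q (γ t) ≤ r₂ + 2 * r₁ + 2 * δ := by
  have hseg := isGeodesicSegment_image_Icc (γ := γ) (a := s) (b := t)
    (fun u _ v _ => by rw [hγ.dist_eq, Real.dist_eq]) le_rfl hst le_rfl
  obtain ⟨m, hm, hsm⟩ := hseg.exists_dist_eq (t := gromovProduct (γ s) q (γ t))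
    (gromovProduct_nonneg _ _ _)
    (by rw [gromovProduct_comm, dist_comm]; exact gromovProduct_le_dist_left _ _ _)
  have h₁ := hX.dist_le_gromovProduct_add hg hseg hm hsm
  -- The products at `q` and at `γ s` sum to `dist q (γ s)`; as `γ` avoids `q`, the former takes up
  -- nearly all of it.
  have h₂ := gromovProduct_add_gromovProduct q (γ s) (γ t)
  have h₃ : Metric.infDist q (Set.range γ) ≤ dist q m := by
    obtain ⟨u, -, rfl⟩ := hm
    exact Metric.infDist_le_dist_of_mem ⟨u, rfl⟩
  have h₄ := gromovProduct_le_add_dist p (γ s) q (γ t)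
  have h₅ := dist_triangle (γ s) p q
  rw [dist_comm (γ s) p] at h₅
  linarith

theorem IsGeodesicallyRich.exists_hasCoarseCenters {δ : ℝ}
    (hX : IsDeltaHyperbolic X δ) (hg : IsGeodesicSpace X) (hrich : IsGeodesicallyRich X)
    (hunb : ∀ R : ℝ, ∃ x y : X, R < dist x y) : ∃ D, HasCoarseCenters X D := by
  obtain ⟨r₀, r₁, r₂, -, -, hrich, -⟩ := hrich
  have h4 := hX.fourPointHyperbolic hg
  refine ⟨max r₁ (r₂ + 2 * r₁ + 5 * δ), fun p => ?_⟩
  obtain ⟨q₀, hq₀⟩ : ∃ q, r₀ ≤ dist p q := by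
    by_contra! h
    obtain ⟨x, y, hxy⟩ := hunb (r₀ + r₀)
    linarith [dist_triangle_left x y p, h x, h y]
  have hgeod : ∀ q, r₀ ≤ dist p q → ∃ γ : ℝ → X, Isometry γ ∧ (∃ s, dist p (γ s) < r₁) ∧
      dist p q - r₂ ≤ Metric.infDist q (Set.range γ) := by
    intro q hq
    obtain ⟨γ, hγ, h₁, h₂⟩ := hrich p q hq
    obtain ⟨-, ⟨s, rfl⟩, hs⟩ := (Metric.infDist_lt_iff (Set.range_nonempty γ)).1 h₁
    exact ⟨γ, hγ, ⟨s, hs⟩, by linarith [(abs_lt.1 h₂).1]⟩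
  obtain ⟨γ, hγ, ⟨s, hs⟩, -⟩ := hgeod q₀ hq₀
  -- The second bound lets richness apply to `p` and `γ (s + T)`; the third makes the end of `γ`
  -- share more with `γ (s + T)`, seen from `p`, than the ends of `γ'` do, by over `3 * δ`.
  obtain ⟨T, hT₀, hT₁, hT₂⟩ : ∃ T : ℝ, 0 ≤ T ∧ r₀ + r₁ ≤ T ∧ r₂ + 3 * r₁ + 5 * δ + 1 ≤ T :=
    ⟨max 0 (max (r₀ + r₁) (r₂ + 3 * r₁ + 5 * δ + 1)), by simp, by simp, by simp⟩
  have hsT : dist (γ s) (γ (s + T)) = T := by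
    rw [hγ.dist_eq, Real.dist_eq, abs_sub_comm, add_sub_cancel_left, abs_of_nonneg hT₀]
  obtain ⟨γ', hγ', ⟨s', hs'⟩, hq⟩ := hgeod (γ (s + T)) (by
    have := dist_triangle_left (γ s) (γ (s + T)) p
    linarith)
  have hray : ∀ t ≥ s + T, T - r₁ ≤ gromovProduct p (γ (s + T)) (γ t) := by
    intro t ht
    have h₁ := gromovProduct_le_add_dist (γ s) p (γ (s + T)) (γ t)
    rw [hγ.gromovProduct_eq, add_sub_cancel_left, abs_of_nonneg hT₀,
      abs_of_nonneg (by linarith : 0 ≤ t - s), abs_sub_comm,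
      abs_of_nonneg (by linarith : 0 ≤ t - (s + T)), dist_comm] at h₁
    linarith
  have hcross : ∀ (σ : ℝ → X), Isometry σ → (∃ u, dist p (σ u) < r₁) →
      dist p (γ (s + T)) - r₂ ≤ Metric.infDist (γ (s + T)) (Set.range σ) →
      ∀ᶠ n : ℕ in atTop, gromovProduct p (γ n) (σ n) ≤ r₂ + 2 * r₁ + 5 * δ := by
    rintro σ hσ ⟨u, hu⟩ hq
    filter_upwards [tendsto_natCast_atTop_atTop.eventually_ge_atTop (s + T),
      tendsto_natCast_atTop_atTop.eventually_ge_atTop u] with n hn₁ hn₂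
    have h₁ := hX.gromovProduct_le_of_infDist hg hσ hu.le hq hn₂
    have h₂ := hray n hn₁
    rw [gromovProduct_comm] at h₁ h₂ ⊢
    linarith [h4.le_max h₁ (y := γ n) (by linarith)]
  have h01 := hcross γ' hγ' ⟨s', hs'⟩ hq
  have h02 := hcross _ hγ'.comp_neg ⟨-s', by simpa using hs'⟩
    (by rwa [show Set.range (fun t => γ' (-t)) = Set.range γ' from neg_surjective.range_comp γ'])
  have h12 : ∀ᶠ n : ℕ in atTop, gromovProduct p (γ' n) (γ' (-n)) ≤ r₁ := by
    filter_upwards [tendsto_natCast_atTop_atTop.eventually_ge_atTop |s'|] with n hn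
    refine (gromovProduct_le_dist_of_between (m := γ' s') ?_).trans hs'.le
    simp only [hγ'.dist_eq, Real.dist_eq]
    obtain ⟨h₁, h₂⟩ := abs_le.1 hn
    rw [abs_of_nonneg (by linarith), abs_of_nonneg (by linarith), abs_of_nonneg (by linarith)]
    ring
  have h01' := h01.mono fun n h => h.trans (le_max_right r₁ _)
  have h02' := h02.mono fun n h => h.trans (le_max_right r₁ _)
  have h12' := h12.mono fun n h => h.trans (le_max_left _ (r₂ + 2 * r₁ + 5 * δ))
  have h10' := h01'.mono fun n h => (gromovProduct_comm p (γ' n) (γ n)).trans_le h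
  have h20' := h02'.mono fun n h => (gromovProduct_comm p (γ' (-n)) (γ n)).trans_le h
  have h21' := h12'.mono fun n h => (gromovProduct_comm p (γ' (-n)) (γ' n)).trans_le h
  refine ⟨![fun n => γ n, fun n => γ' n, fun n => γ' (-n)], ?_, ?_⟩
  · intro a
    fin_cases a
    · exact hγ.isGromovSequence
    · exact hγ'.isGromovSequence
    · exact hγ'.comp_neg.isGromovSequence
  · intro a b hab
    fin_cases a <;> fin_cases b <;> first | exact absurd rfl hab | assumption

/-- Coarse centers can be pulled back along a map that coarsely increases Gromov products and is
surjective on the boundary. -/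
theorem HasCoarseCenters.of_surjective {δ D A B : ℝ} (hY : FourPointHyperbolic Y δ)
    (h : HasCoarseCenters Y D) {f : X → Y} (hA : 0 < A)
    (hf : ∀ p x y, gromovProduct p x y ≤ A * gromovProduct (f p) (f x) (f y) + B)
    {F : GromovBoundary X → GromovBoundary Y} (hfF : InducesBoundaryMap f F)
    (hF : Function.Surjective F) : HasCoarseCenters X (A * (D + 2 * δ) + B) := by
  intro p
  obtain ⟨y, hy, hyD⟩ := h (f p)
  have hpre : ∀ a, ∃ x : ℕ → X, IsGromovSequence x ∧ GromovEquivalent (y a) (fun i => f (x i)) := by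
    intro a
    obtain ⟨ξ, hξ⟩ := hF (GromovBoundary.mk (y a) (hy a))
    obtain ⟨x, hx, rfl⟩ := ξ.exists_mk_eq
    obtain ⟨hfx, hx'⟩ := hfF x hx
    exact ⟨x, hx, GromovBoundary.gromovEquivalent_of_mk_eq hY (hξ.symm.trans hx')⟩
  choose x hx hxy using hpre
  refine ⟨x, hx, fun a b hab => ?_⟩
  filter_upwards [hyD a b hab, (hxy a).eventually_lt (f p) (D + 2 * δ),
    (hxy b).eventually_lt (f p) (D + δ)] with m h₁ h₂ h₃
  have h₄ := mul_le_mul_of_nonneg_left (hY.gromovProduct_le_of_lt h₁ h₂ h₃) hA.le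
  linarith [hf p (x a m) (x b m)]

theorem HasCoarseCenters.isBoundaryRigid {δ D : ℝ} (hδ : 0 ≤ δ) (hX : IsDeltaHyperbolic X δ)
    (hg : IsGeodesicSpace X) (h : HasCoarseCenters X D) : IsBoundaryRigid X := by
  intro g hgqi hgid
  have h4 := hX.fourPointHyperbolic hg
  obtain ⟨A, B, hA, hAB⟩ := hgqi.exists_gromovProduct_le hδ hX hg hg
  -- `A * D + B` bounds the image triple at `g p`; the rest pays for replacing `g (z a m)` by `z a
  -- m`.
  set D' := max D (A * D + B + 2 * (3 * δ)) with hD'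
  refine ⟨2 * (D' + 3 * δ), fun p => ?_⟩
  obtain ⟨z, hz, hzD⟩ := h p
  have hzg : ∀ a, GromovEquivalent (fun i => g (z a i)) (z a) := by
    intro a
    obtain ⟨hgz, h⟩ := hgid (z a) (hz a)
    exact (GromovBoundary.gromovEquivalent_of_mk_eq h4 h).symm
  have hall : ∀ a b, ∀ᶠ m in atTop, a ≠ b → gromovProduct p (z a m) (z b m) ≤ D' ∧
      gromovProduct (g p) (z a m) (z b m) ≤ D' := by
    intro a b
    by_cases hab : a = b
    · exact .of_forall fun _ hab' => absurd hab hab'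
    filter_upwards [hzD a b hab, (hzg a).eventually_lt (g p) (A * D + B + 2 * (3 * δ)),
      (hzg b).eventually_lt (g p) (A * D + B + 3 * δ)] with m h₁ h₂ h₃ _
    refine ⟨h₁.trans (le_max_left _ _), ?_⟩
    have h₄ : gromovProduct (g p) (g (z a m)) (g (z b m)) ≤ A * D + B :=
      (hAB _ _ _).trans (by gcongr)
    exact (h4.gromovProduct_le_of_lt h₄ h₂ h₃).trans (le_max_right _ _)
  obtain ⟨m, hm⟩ := (eventually_all.2 fun a => eventually_all.2 fun b => hall a b).exists
  obtain ⟨a, ha₁, ha₂⟩ := h4.exists_gromovProduct_le (z := fun a => z a m)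
    (fun a b hab => (hm a b hab).1) (fun a b hab => (hm a b hab).2) (g p) p
  have h₁ := gromovProduct_add_gromovProduct p (g p) (z a m)
  rw [gromovProduct_comm p, gromovProduct_comm (g p), dist_comm] at h₁
  linarith

end CoarseCenters

/-! ### Gromov products of boundary points. -/

section BoundaryProduct

variable {X : Type*} [MetricSpace X]

theorem boundaryGromovProduct_le {w : X} {x y : ℕ → X} (hx : IsGromovSequence x)
    (hy : IsGromovSequence y) {c : ℝ} (h : ∀ᶠ i in atTop, gromovProduct w (x i) (y i) ≤ c) :
    boundaryGromovProduct w (.mk x hx) (.mk y hy) ≤ c :=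
  le_trans (sInf_le ⟨x, y, hx, hy, rfl, rfl, rfl⟩) <|
    liminf_le_of_frequently_le' (h.mono fun _ hi => EReal.coe_le_coe_iff.2 hi).frequently

theorem le_boundaryGromovProduct {w : X} {ξ ζ : GromovBoundary X} {c : ℝ}
    (h : ∀ (x y : ℕ → X) (hx : IsGromovSequence x) (hy : IsGromovSequence y),
      GromovBoundary.mk x hx = ξ → GromovBoundary.mk y hy = ζ →
        ∀ᶠ i in atTop, c ≤ gromovProduct w (x i) (y i)) :
    c ≤ boundaryGromovProduct w ξ ζ := by
  refine le_sInf ?_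
  rintro _ ⟨x, y, hx, hy, hxξ, hyζ, rfl⟩
  exact le_liminf_of_le (h := (h x y hx hy hxξ hyζ).mono fun _ hi => EReal.coe_le_coe_iff.2 hi)

theorem eventually_lt_gromovProduct {w : X} {x y : ℕ → X} {hx : IsGromovSequence x}
    {hy : IsGromovSequence y} {c : ℝ} (h : c < boundaryGromovProduct w (.mk x hx) (.mk y hy)) :
    ∀ᶠ i in atTop, c < gromovProduct w (x i) (y i) :=
  (eventually_lt_of_lt_liminf (h.trans_le (sInf_le ⟨x, y, hx, hy, rfl, rfl, rfl⟩))).mono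
    fun _ hi => EReal.coe_lt_coe_iff.1 hi

theorem boundaryGromovProduct_nonneg (w : X) (ξ ζ : GromovBoundary X) :
    0 ≤ boundaryGromovProduct w ξ ζ :=
  le_boundaryGromovProduct (c := 0) fun _ _ _ _ _ _ =>
    .of_forall fun _ => gromovProduct_nonneg _ _ _

theorem FourPointHyperbolic.boundaryGromovProduct_self {δ : ℝ} (h : FourPointHyperbolic X δ)
    (w : X) (ξ : GromovBoundary X) : boundaryGromovProduct w ξ ξ = ⊤ := by
  refine EReal.eq_top_iff_forall_lt _ |>.2 fun c => ?_
  refine lt_of_lt_of_le (EReal.coe_lt_coe_iff.2 (lt_add_one c)) (le_boundaryGromovProduct ?_)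
  rintro x y hx hy rfl hyx
  exact ((GromovBoundary.gromovEquivalent_of_mk_eq h hyx).symm.eventually_lt w _).mono
    fun _ hi => hi.le

/-- The infimum over all representatives lets one sequence for `η` serve both pairs, so only a
single `δ` is lost. -/
theorem FourPointHyperbolic.le_boundaryGromovProduct {δ : ℝ} (h : FourPointHyperbolic X δ)
    {w : X} {ξ η ζ : GromovBoundary X} {c : ℝ} (h₁ : c < boundaryGromovProduct w ξ η)
    (h₂ : c < boundaryGromovProduct w η ζ) :
    ((c - δ : ℝ) : EReal) ≤ boundaryGromovProduct w ξ ζ := by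
  obtain ⟨y, hy, rfl⟩ := η.exists_mk_eq
  refine _root_.le_boundaryGromovProduct ?_
  rintro x z hx hz rfl rfl
  filter_upwards [eventually_lt_gromovProduct h₁, eventually_lt_gromovProduct h₂] with i hi₁ hi₂
  have := h w (x i) (y i) (z i)
  have := lt_min hi₁ hi₂
  linarith

end BoundaryProduct

/-! ### Comparison of the visual metric with `exp (-ε (ξ|ζ)_w)`. -/

section VisualMetric

variable {X : Type*} [MetricSpace X]

theorem visualQuasiDist_eq_zero {w : X} {ε : ℝ} (hε : 0 < ε) {ξ ζ : GromovBoundary X}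
    (h : boundaryGromovProduct w ξ ζ = ⊤) : visualQuasiDist w ε ξ ζ = 0 := by
  simp [visualQuasiDist, h, EReal.coe_mul_top_of_pos hε]

theorem visualQuasiDist_eq_exp {w : X} {ε g : ℝ} {ξ ζ : GromovBoundary X}
    (h : boundaryGromovProduct w ξ ζ = g) : visualQuasiDist w ε ξ ζ = Real.exp (-(ε * g)) := by
  rw [visualQuasiDist, h, ← EReal.coe_mul, ← EReal.coe_neg, EReal.exp_coe,
    ENNReal.toReal_ofReal (Real.exp_pos _).le]

theorem boundaryGromovProduct_eq_top_or (w : X) (ξ ζ : GromovBoundary X) :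
    boundaryGromovProduct w ξ ζ = ⊤ ∨ ∃ g : ℝ, boundaryGromovProduct w ξ ζ = g := by
  have := boundaryGromovProduct_nonneg w ξ ζ
  induction h : boundaryGromovProduct w ξ ζ with
  | bot => simp [h] at this
  | coe g => exact Or.inr ⟨g, rfl⟩
  | top => exact Or.inl rfl

theorem visualQuasiDist_le_exp_iff {w : X} {ε c : ℝ} (hε : 0 < ε) {ξ ζ : GromovBoundary X} :
    visualQuasiDist w ε ξ ζ ≤ Real.exp (-(ε * c)) ↔ c ≤ boundaryGromovProduct w ξ ζ := by
  obtain h | ⟨g, h⟩ := boundaryGromovProduct_eq_top_or w ξ ζ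
  · rw [visualQuasiDist_eq_zero hε h, h]
    simp [(Real.exp_pos _).le]
  · rw [visualQuasiDist_eq_exp h, h, Real.exp_le_exp, neg_le_neg_iff, mul_le_mul_iff_right₀ hε,
      EReal.coe_le_coe_iff]

theorem exp_le_visualQuasiDist_iff {w : X} {ε c : ℝ} (hε : 0 < ε) {ξ ζ : GromovBoundary X} :
    Real.exp (-(ε * c)) ≤ visualQuasiDist w ε ξ ζ ↔ boundaryGromovProduct w ξ ζ ≤ c := by
  obtain h | ⟨g, h⟩ := boundaryGromovProduct_eq_top_or w ξ ζ
  · rw [visualQuasiDist_eq_zero hε h, h]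
    simp [Real.exp_pos]
  · rw [visualQuasiDist_eq_exp h, h, Real.exp_le_exp, neg_le_neg_iff, mul_le_mul_iff_right₀ hε,
      EReal.coe_le_coe_iff]

theorem visualQuasiDist_nonneg (w : X) (ε : ℝ) (ξ ζ : GromovBoundary X) :
    0 ≤ visualQuasiDist w ε ξ ζ :=
  ENNReal.toReal_nonneg

theorem FourPointHyperbolic.visualQuasiDist_le {δ : ℝ} (h : FourPointHyperbolic X δ) (w : X)
    {ε : ℝ} (hε : 0 < ε) (ξ η ζ : GromovBoundary X) :
    visualQuasiDist w ε ξ ζ ≤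
      Real.exp (ε * δ) * max (visualQuasiDist w ε ξ η) (visualQuasiDist w ε η ζ) := by
  have hK := Real.exp_pos (ε * δ)
  rw [← div_le_iff₀' hK]
  -- Going strictly above the maximum makes `r` positive, so that its logarithm makes sense, and the
  -- product bounds strict.
  refine le_of_forall_gt_imp_ge_of_dense fun r hr => ?_
  have hr₀ : 0 < r := ((visualQuasiDist_nonneg w ε ξ η).trans (le_max_left _ _)).trans_lt hr
  have hre : r = Real.exp (-(ε * (-Real.log r / ε))) := by
    rw [mul_div_cancel₀ _ hε.ne', neg_neg, Real.exp_log hr₀]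
  set c := -Real.log r / ε
  have key : ∀ α β : GromovBoundary X, visualQuasiDist w ε α β < r →
      (c : EReal) < boundaryGromovProduct w α β := by
    intro α β hαβ
    rw [hre] at hαβ
    exact not_le.1 fun hc => absurd ((exp_le_visualQuasiDist_iff hε).2 hc) (not_le.2 hαβ)
  have h₁ := (visualQuasiDist_le_exp_iff hε).2 (h.le_boundaryGromovProduct
    (key ξ η ((le_max_left _ _).trans_lt hr)) (key η ζ ((le_max_right _ _).trans_lt hr)))
  rw [div_le_iff₀' hK, hre, ← Real.exp_add]
  rwa [show ε * δ + -(ε * c) = -(ε * (c - δ)) by ring]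

/-- Frink's chain lemma. -/
theorem le_two_mul_sum_of_le_mul_max {α : Type*} {ρ : α → α → ℝ} {K : ℝ}
    (hρ₀ : ∀ x y, 0 ≤ ρ x y) (hρ : ∀ x, ρ x x = 0) (hK₁ : 1 ≤ K) (hK₂ : K * K ≤ 2)
    (hmax : ∀ x y z, ρ x z ≤ K * max (ρ x y) (ρ y z)) (n : ℕ) :
    ∀ c : ℕ → α, ρ (c 0) (c n) ≤ 2 * ∑ i ∈ Finset.range n, ρ (c i) (c (i + 1)) := by
  induction n using Nat.strong_induction_on with
  | _ n ih =>
    intro c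
    obtain rfl | hn := Nat.eq_zero_or_pos n
    · simp [hρ]
    set s : ℕ → ℝ := fun m => ∑ i ∈ Finset.range m, ρ (c i) (c (i + 1)) with hs
    have hs₀ : ∀ m, 0 ≤ s m := fun m => Finset.sum_nonneg fun _ _ => hρ₀ _ _
    have hsplit : ∀ m ≤ n, s n = s m + ∑ i ∈ Finset.range (n - m), ρ (c (m + i)) (c (m + i + 1)) := by
      intro m hm
      conv_lhs => rw [← Nat.add_sub_cancel' hm]
      exact Finset.sum_range_add _ _ _
    -- The link from `m` to `m + 1` straddles half the total. By induction both outer pieces have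
    -- `ρ` at most `s n`; rejoining the three costs `K` twice.
    obtain ⟨m, hm, hm₁, hm₂⟩ : ∃ m < n, s m ≤ s n / 2 ∧ s n - s (m + 1) ≤ s n / 2 := by
      classical
      set m := Nat.findGreatest (fun m => s m ≤ s n / 2) (n - 1) with hm
      have hmn : m ≤ n - 1 := Nat.findGreatest_le _
      refine ⟨m, by omega, Nat.findGreatest_spec (P := fun m => s m ≤ s n / 2) (Nat.zero_le _) ?_, ?_⟩
      · simpa [hs] using div_nonneg (hs₀ n) zero_le_two
      · obtain h | h : m + 1 = n ∨ m + 1 ≤ n - 1 := by omega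
        · rw [h, sub_self]; linarith [hs₀ n]
        · have := Nat.findGreatest_is_greatest (hm ▸ Nat.lt_succ_self m) h
          linarith
    have h₁ := ih m hm c
    have h₂ := ih (n - (m + 1)) (by omega) fun i => c (m + 1 + i)
    simp only [add_zero, Nat.add_sub_cancel' (Nat.succ_le_of_lt hm)] at h₂
    have h₃ := hsplit (m + 1) hm
    have h₄ : ρ (c m) (c (m + 1)) ≤ s n := by
      have : s (m + 1) = s m + ρ (c m) (c (m + 1)) := Finset.sum_range_succ _ _
      have : 0 ≤ ∑ i ∈ Finset.range (n - (m + 1)), ρ (c (m + 1 + i)) (c (m + 1 + i + 1)) :=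
        Finset.sum_nonneg fun _ _ => hρ₀ _ _
      linarith [hs₀ m]
    have h₅ : ρ (c (m + 1)) (c n) ≤ s n := by
      simp only [← add_assoc] at h₂
      linarith
    have h₆ : ρ (c m) (c n) ≤ K * s n :=
      (hmax _ _ _).trans (mul_le_mul_of_nonneg_left (max_le h₄ h₅) (by linarith))
    have h₇ : ρ (c 0) (c m) ≤ K * s n := by
      have : s n ≤ K * s n := le_mul_of_one_le_left (hs₀ n) hK₁
      linarith
    have h₈ := (hmax (c 0) (c m) (c n)).trans
      (mul_le_mul_of_nonneg_left (max_le h₇ h₆) (by linarith))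
    have h₉ := mul_le_mul_of_nonneg_right hK₂ (hs₀ n)
    linarith

theorem visualDist_le_visualQuasiDist (w : X) (ε : ℝ) (ξ ζ : GromovBoundary X) :
    visualDist w ε ξ ζ ≤ visualQuasiDist w ε ξ ζ := by
  refine csInf_le ⟨0, ?_⟩ ⟨1, fun i => if i = 0 then ξ else ζ, le_rfl, by simp, by simp, by simp⟩
  rintro _ ⟨n, c, -, -, -, rfl⟩
  exact Finset.sum_nonneg fun _ _ => visualQuasiDist_nonneg _ _ _ _

theorem FourPointHyperbolic.visualQuasiDist_le_two_mul_visualDist {δ : ℝ}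
    (h : FourPointHyperbolic X δ) (hδ : 0 ≤ δ) (w : X) {ε : ℝ} (hε : 0 < ε)
    (hεδ : ε * δ ≤ 1 / 5) (ξ ζ : GromovBoundary X) :
    visualQuasiDist w ε ξ ζ ≤ 2 * visualDist w ε ξ ζ := by
  rw [← div_le_iff₀' two_pos]
  refine le_csInf ⟨_, 1, fun i => if i = 0 then ξ else ζ, le_rfl, by simp, by simp, rfl⟩ ?_
  rintro _ ⟨n, c, -, rfl, rfl, rfl⟩
  rw [div_le_iff₀' two_pos]
  refine le_two_mul_sum_of_le_mul_max (visualQuasiDist_nonneg w ε)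
    (fun x => visualQuasiDist_eq_zero hε (h.boundaryGromovProduct_self w x))
    (Real.one_le_exp (by positivity)) ?_ (h.visualQuasiDist_le w hε) n c
  -- The square of `exp (ε * δ)` is at most `exp (2 / 5)`, and `2 / 5 < log 2`.
  rw [← Real.exp_add, ← Real.le_log_iff_exp_le two_pos]
  linarith [Real.log_two_gt_d9]

end VisualMetric

/-! ### Uniform perfectness of the boundary. -/

section UniformPerfectness

variable {X : Type*} [MetricSpace X]

/-- From every base point, boundary points can be found at every prescribed distance from a given
one. -/
theorem HasCoarseCenters.exists_boundaryGromovProduct {δ D : ℝ} (hδ : 0 ≤ δ)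
    (hg : IsGeodesicSpace X) (h4 : FourPointHyperbolic X δ) (h : HasCoarseCenters X D) (w : X)
    (ξ : GromovBoundary X) {t : ℝ} (ht : 0 ≤ t) : ∃ ζ : GromovBoundary X,
      ((t - (|D| + 6 * δ + 1) : ℝ) : EReal) ≤ boundaryGromovProduct w ξ ζ ∧
        boundaryGromovProduct w ξ ζ ≤ ((t + (|D| + 6 * δ + 1) : ℝ) : EReal) := by
  have hD := le_abs_self D
  have hD₀ := abs_nonneg D
  obtain ⟨x, hx, rfl⟩ := ξ.exists_mk_eq
  obtain ⟨N₀, hN₀⟩ := hx.exists_forall_lt w t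
  obtain ⟨s, hs⟩ := hg w (x N₀)
  have hN₀t := hN₀ N₀ N₀ le_rfl le_rfl
  rw [gromovProduct_self, dist_comm] at hN₀t
  obtain ⟨p, hp, hwp⟩ := hs.exists_dist_eq ht hN₀t.le
  have hxp : ∀ i, N₀ ≤ i → gromovProduct p (x i) w ≤ δ := by
    intro i hi
    have h₁ := h4 w (x i) (x N₀) p
    have h₂ : gromovProduct w (x N₀) p = t := by
      have := hs.dist_add_dist hp
      rw [gromovProduct, dist_comm (x N₀) w, dist_comm p w, dist_comm (x N₀) p]
      linarith
    rw [h₂, min_eq_right (hN₀ i N₀ hi le_rfl).le] at h₁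
    have h₃ := gromovProduct_add_gromovProduct w p (x i)
    rw [gromovProduct_comm w, gromovProduct_comm p, dist_comm p w] at h₃
    linarith
  obtain ⟨z, hz, hzD⟩ := h p
  set B := t + |D| + 10 * δ with hB
  have hstable : ∀ {y : ℕ → X}, IsGromovSequence y →
      ∀ᶠ N in atTop, ∀ i ≥ N, B < gromovProduct w (y N) (y i) := by
    intro y hy
    obtain ⟨N, hN⟩ := hy.exists_forall_lt w B
    filter_upwards [eventually_ge_atTop N] with m hm i hi using hN m i hm (hm.trans hi)
  have hpair : ∀ a b, ∀ᶠ m in atTop, a ≠ b → gromovProduct p (z a m) (z b m) ≤ D := by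
    intro a b
    by_cases hab : a = b
    · exact .of_forall fun _ hab' => absurd hab hab'
    · exact (hzD a b hab).mono fun _ hm _ => hm
  obtain ⟨N, hN₀N, hxN, hzN, hN⟩ := ((eventually_ge_atTop N₀).and ((hstable hx).and
    ((eventually_all.2 fun a => hstable (hz a)).and
      (eventually_all.2 fun a => eventually_all.2 fun b => hpair a b)))).exists
  obtain ⟨a, ha₁, ha₂⟩ := h4.exists_gromovProduct_le (z := fun a => z a N) hN hN w (x N)
  -- All three products at `p` are bounded, which puts this one within `|D| + 2 * δ` of `t`.
  have hsum : gromovProduct w (x N) (z a N) = t - gromovProduct p (z a N) w -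
      gromovProduct p (x N) w + gromovProduct p (z a N) (x N) := by
    simp only [gromovProduct, ← hwp, dist_comm (z a N) (x N), dist_comm w p]
    ring
  have hxp := hxp N hN₀N
  refine ⟨.mk (z a) (hz a), le_boundaryGromovProduct ?_, boundaryGromovProduct_le hx (hz a) ?_⟩
  · intro x' z' hx' hz' hxx' hzz'
    filter_upwards [(GromovBoundary.gromovEquivalent_of_mk_eq h4 hxx').eventually_lt w B,
      (GromovBoundary.gromovEquivalent_of_mk_eq h4 hzz').eventually_lt w B,
      eventually_ge_atTop N] with i h₁ h₂ hi
    -- Passing to the chosen representatives and then to index `N` costs `2 * δ` each, whence `6 * δ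
    -- + 1` in the statement.
    by_contra! hc
    have h₃ := h4.gromovProduct_le_of_lt hc.le (x' := x i) (y' := z a i) (by linarith)
      (by linarith)
    have h₄ := hxN i hi
    have h₅ := hzN a i hi
    rw [gromovProduct_comm] at h₄ h₅
    have h₆ := h4.gromovProduct_le_of_lt h₃ (x' := x N) (y' := z a N) (by linarith)
      (by linarith)
    linarith [gromovProduct_nonneg p (z a N) (x N)]
  · filter_upwards [eventually_ge_atTop N] with i hi
    have h₁ := hxN i hi
    have h₂ := hzN a i hi
    have h₃ : gromovProduct w (x N) (z a N) ≤ t + |D| + δ := by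
      linarith [gromovProduct_nonneg p (z a N) w, gromovProduct_nonneg p (x N) w]
    have := h4.gromovProduct_le_of_lt h₃ (x' := x i) (y' := z a i) (by linarith) (by linarith)
    linarith

theorem HasCoarseCenters.hasUniformlyPerfectBoundary {D : ℝ} (hg : IsGeodesicSpace X)
    (h : HasCoarseCenters X D) : HasUniformlyPerfectBoundary X := by
  intro w δ ε hδ hthin hε hεδ
  have h4 := hthin.fourPointHyperbolic hg
  have hεδ' : ε * δ ≤ 1 / 5 := by
    have h₁ := (hεδ.trans_le (min_le_right _ _)).le
    rw [le_div_iff₀ (by positivity)] at h₁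
    linarith
  set C := |D| + 6 * δ + 1 with hC
  have hC₀ : 0 ≤ C := by positivity
  -- The exponential is the spread `2 * C` of the product; Frink's lemma costs `2`, and `3` makes
  -- the inequality strict. `r ≤ 1` keeps the height `-log r / ε` nonnegative.
  refine ⟨3 * Real.exp (ε * (2 * C)), ?_, 1, one_pos, fun ξ r hr hr₁ => ?_⟩
  · linarith [Real.one_le_exp (x := ε * (2 * C)) (by positivity)]
  have hlog : 0 ≤ -Real.log r / ε :=
    div_nonneg (neg_nonneg.2 (Real.log_nonpos hr.le hr₁)) hε.le
  have hre : Real.exp (-(ε * (-Real.log r / ε))) = r := by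
    rw [mul_div_cancel₀ _ hε.ne', neg_neg, Real.exp_log hr]
  obtain ⟨ζ, hζ₁, hζ₂⟩ := h.exists_boundaryGromovProduct hδ.le hg h4 w ξ (add_nonneg hlog hC₀)
  rw [← hC, ← visualQuasiDist_le_exp_iff hε, add_sub_cancel_right, hre] at hζ₁
  rw [← hC, ← exp_le_visualQuasiDist_iff hε] at hζ₂
  refine ⟨ζ, ?_, (visualDist_le_visualQuasiDist w ε ξ ζ).trans hζ₁⟩
  have h₁ := h4.visualQuasiDist_le_two_mul_visualDist hδ.le w hε hεδ' ξ ζ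
  have h₂ : r / Real.exp (ε * (2 * C)) ≤ 2 * visualDist w ε ξ ζ := by
    refine le_trans (le_of_eq ?_) (hζ₂.trans h₁)
    conv_lhs => rw [← hre, ← Real.exp_sub]
    congr 1; ring
  have h₃ : 0 < r / Real.exp (ε * (2 * C)) := by positivity
  rw [mul_comm, ← div_div]
  linarith

end UniformPerfectness

theorem corollary1p4 {X Y : Type*} [MetricSpace X] [ProperSpace X] [MetricSpace Y]
    (hXgeod : IsGeodesicSpace X) (hXhyp : IsGromovHyperbolic X)
    (hYgeod : IsGeodesicSpace Y) (hYhyp : IsGromovHyperbolic Y) (hYrich : IsGeodesicallyRich Y)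
    (f : X → Y) (hf : IsQuasiIsometricEmbedding f)
    (F : GromovBoundary X → GromovBoundary Y) (hfF : InducesBoundaryMap f F)
    (hF : Function.Bijective F) :
    IsBoundaryRigid X ∧ HasUniformlyPerfectBoundary X := by
  obtain ⟨δX, hδX, hX⟩ := hXhyp
  obtain ⟨δY, hδY, hY⟩ := hYhyp
  obtain ⟨K, C, hK, hC, hKC⟩ := hf
  by_cases hunb : ∀ R : ℝ, ∃ x y : Y, R < dist x y
  · obtain ⟨D, hD⟩ := hYrich.exists_hasCoarseCenters hY hYgeod hunb
    obtain ⟨A, B, hA, hAB⟩ := hKC.exists_gromovProduct_le hδY hY hXgeod hYgeod hK hC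
    have h := hD.of_surjective (hY.fourPointHyperbolic hYgeod) hA hAB hfF hF.surjective
    exact ⟨h.isBoundaryRigid hδX hX hXgeod, h.hasUniformlyPerfectBoundary hXgeod⟩
  -- If `Y` is bounded, richness may be vacuous, but then `X` is bounded and `∂X` is empty.
  · push Not at hunb
    obtain ⟨R, hR⟩ := hunb
    have hX' : ∀ x y : X, dist x y ≤ K * (R + C) := by
      intro x y
      rw [← inv_mul_le_iff₀ (by linarith)]
      linarith [(hKC x y).1, hR (f x) (f y)]
    refine ⟨fun g _ _ => ⟨_, fun x => hX' x (g x)⟩, fun w δ ε _ _ _ _ => ?_⟩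
    refine ⟨1, le_rfl, 1, one_pos, fun ξ => ?_⟩
    obtain ⟨x, hx, -⟩ := ξ.exists_mk_eq
    exact absurd hx (not_isGromovSequence_of_dist_le hX' x)
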